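/- There is a function $\varepsilon:\mathbb{N}\to\mathbb{R}$ with $\varepsilon(d)\to 0$ as $d\to\infty$ such that for every positive integer $g$ and every $d\ge 1$ there exists a finite simple graph $G$ such that 1. $G$ is an orthogonality graph in the unit sphere $\mathbb{S}^{d-1}=\{x\in\mathbb{R}^d : \|x\|=1\}$, i.e. the vertices of $G$ can be assigned distinct vectors of $\mathbb{S}^{d-1}$ in such a way that any two adjacent vertices are assigned orthogonal vectors (vectors assigned to non-adjacent vertices may or may not be orthogonal); 2. $G$ has girth at least $g$, i.e. $G$ contains no cycle of length less than $g$ (the girth of a graph without cycles is $\infty$); 3. $\chi(G)\ge (1.074+\varepsilon(d))^d$, where $\chi(G)$ is the chromatic number of $G$. -/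

import Mathlib

/-- A graph `G` is an orthogonality graph in a set `S` of vectors of `ℝ^d` if its vertices can be
assigned distinct vectors of `S` so that adjacent vertices are assigned orthogonal vectors.
The assignment need not be faithful: non-adjacent vertices may receive orthogonal vectors. -/
def SimpleGraph.IsOrthogonalityGraph {V : Type*} {d : ℕ} (G : SimpleGraph V)
    (S : Set (EuclideanSpace ℝ (Fin d))) : Prop :=
  ∃ f : V → EuclideanSpace ℝ (Fin d), Function.Injective f ∧ (∀ v, f v ∈ S) ∧
    ∀ u v, G.Adj u v → inner ℝ (f u) (f v) = 0

open Filter Topology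

/-! ### Chebyshev's estimates and primes in short multiplicative intervals -/

namespace Chebyshev

/-! The source of large chromatic number is the Frankl–Wilson method on vectors in {-1, 0, 1}^n with
p - 1 nonzero entries, p prime, joined when their inner product is -1. Inner products lie between
-(p-1) and p-1, and the only ones congruent to -1 mod p are -1 and p-1. Hence on an independent set
the polynomials ∏_{j<p-1} (⟨x,y⟩ - j) over `ZMod p` form a diagonal matrix with nonzero diagonal,
which bounds the set by the number of reduced monomials of degree at most p-1
(`SignVector.card_le_card_exponents`). Dividing the number of vertices by this bound shows that many
colors are needed.

With p - 1 = κn, the entropy bound for binomial coefficients and an exponential-moment bound for the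
monomials make this ratio at least about 1.1535^n for all κ in [7/18, 21/46]
(`exists_log_le_signRate`). Chebyshev's estimates are sharp enough to supply a prime in that window.

Large girth comes from sparse incomparability (`SimpleGraph.exists_large_girth_not_colorable`):
edges of a blow-up are added greedily, each one destroying a fixed proportion of the remaining
proper colorings, until none is left.

An extra coordinate 1 turns inner product -1 into 0. The copies of a vertex in the blow-up need
distinct vectors, so each vector is tensored with unit vectors of the plane, which preserves
orthogonality. The dimension becomes 2(n+1), and the final base is 1.074 because 1.074² < 1.1535. -/

theorem log_factorial_le {n : ℕ} (hn : n ≠ 0) :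
    Real.log n.factorial ≤ n * Real.log n - n + Real.log n + 1 := by
  induction n with
  | zero => simp at hn
  | succ n ih =>
    rcases Nat.eq_zero_or_pos n with rfl | h
    · simp
    have ih := ih h.ne'
    have hn0 : (0 : ℝ) < n := by exact_mod_cast h
    rw [Nat.factorial_succ, Nat.cast_mul, Real.log_mul (by positivity) (by positivity)]
    have key : 1 - (((n : ℝ) + 1) / n)⁻¹ ≤ Real.log (((n : ℝ) + 1) / n) :=
      Real.one_sub_inv_le_log_of_pos (by positivity)
    rw [Real.log_div (by positivity) (by positivity)] at key
    have h2 : 1 - (((n : ℝ) + 1) / n)⁻¹ = 1 / (n + 1) := by field_simp; ring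
    rw [h2, div_le_iff₀ (by positivity)] at key
    push_cast
    nlinarith

theorem abs_log_floor_factorial_sub_le {x : ℝ} (hx : 1 ≤ x) :
    |Real.log (⌊x⌋₊.factorial : ℝ) - (x * Real.log x - x)| ≤ Real.log x + 1 := by
  have hx0 : 0 < x := by linarith
  set n := ⌊x⌋₊ with hn
  have hn1 : 1 ≤ n := Nat.one_le_floor_iff x |>.2 hx
  have hnx : (n : ℝ) ≤ x := Nat.floor_le hx0.le
  have hxn : x < n + 1 := Nat.lt_floor_add_one x
  have hn0 : (1 : ℝ) ≤ n := by exact_mod_cast hn1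
  have hnpos : (0 : ℝ) < n := by linarith
  have hlogx : 0 ≤ Real.log x := Real.log_nonneg hx
  have hlogn : 0 ≤ Real.log n := Real.log_nonneg hn0
  have hmono : Real.log n ≤ Real.log x := Real.log_le_log hnpos hnx
  have hup := log_factorial_le (n := n) (by omega)
  have hlo := Stirling.le_log_factorial_stirling (n := n) (by omega)
  have hpi : 0 ≤ Real.log (2 * Real.pi) :=
    Real.log_nonneg (by linarith [Real.pi_gt_three])
  have h1 : Real.log x - Real.log n ≤ x / n - 1 := by
    rw [← Real.log_div hx0.ne' hnpos.ne']
    exact Real.log_le_sub_one_of_pos (by positivity)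
  have h2 : 1 - n / x ≤ Real.log x - Real.log n := by
    rw [← Real.log_div hx0.ne' hnpos.ne']
    have := Real.one_sub_inv_le_log_of_pos (x := x / n) (by positivity)
    rwa [inv_div] at this
  have h3 : 1 - 1 / x ≤ Real.log x := by
    simpa using Real.one_sub_inv_le_log_of_pos hx0
  have h1' : n * (Real.log x - Real.log n) ≤ x - n := by
    calc n * (Real.log x - Real.log n) ≤ n * (x / n - 1) := by gcongr
      _ = x - n := by field_simp
  have h2' : n * (1 - n / x) ≤ n * (Real.log x - Real.log n) := by gcongr
  have h4 : 1 - n / x ≤ Real.log x := by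
    refine le_trans ?_ h3
    gcongr
  have h5 : x - n = n * (1 - n / x) + (x - n) * (1 - n / x) := by field_simp; ring
  have h6 : (x - n) * (1 - n / x) ≤ (x - n) * Real.log x := by
    apply mul_le_mul_of_nonneg_left h4; linarith
  have h7 : (x - n) * Real.log x ≤ 1 * Real.log x := by
    apply mul_le_mul_of_nonneg_right _ hlogx; linarith
  rw [abs_le]
  constructor <;> nlinarith

theorem log_factorial_eq_sum_vonMangoldt (N : ℕ) :
    Real.log N.factorial =
      ∑ n ∈ Finset.Ioc 0 N, ArithmeticFunction.vonMangoldt n * ((N / n : ℕ) : ℝ) := by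
  rw [← ArithmeticFunction.sum_Ioc_mul_zeta_eq_sum, ArithmeticFunction.vonMangoldt_mul_zeta]
  simp only [ArithmeticFunction.log_apply]
  induction N with
  | zero => simp
  | succ n ih =>
    rw [Finset.sum_Ioc_succ_top (by omega), ← ih, Nat.factorial_succ, Nat.cast_mul,
      Real.log_mul (by positivity) (by positivity)]
    ring

/-- A sum over `n ≤ N / d` weighted by `⌊(N / d) / n⌋`, extended to all `n ≤ N`. -/
theorem log_factorial_div_eq_sum_vonMangoldt (N d : ℕ) :
    Real.log (N / d).factorial =
      ∑ n ∈ Finset.Ioc 0 N, ArithmeticFunction.vonMangoldt n * ((N / n / d : ℕ) : ℝ) := by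
  rw [log_factorial_eq_sum_vonMangoldt]
  have hsub : Finset.Ioc 0 (N / d) ⊆ Finset.Ioc 0 N :=
    Finset.Ioc_subset_Ioc_right (Nat.div_le_self N d)
  rw [← Finset.sum_subset hsub]
  · refine Finset.sum_congr rfl fun n _ => ?_
    rw [Nat.div_div_eq_div_mul, Nat.div_div_eq_div_mul, mul_comm d n]
  · intro n hn hn'
    simp only [Finset.mem_Ioc, not_and, not_le] at hn hn'
    have : N / n / d = 0 := by
      rw [Nat.div_div_eq_div_mul, mul_comm, ← Nat.div_div_eq_div_mul]
      exact Nat.div_eq_of_lt (hn' hn.1)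
    simp [this]

/-- Since n ≤ N / d iff d ≤ N / n, values of ψ become sums over the same range as `chebyshevSum`, so
the two can be compared coefficient by coefficient in y = N / n. -/
theorem psi_div_eq_sum (N : ℕ) {d : ℕ} (hd : 0 < d) :
    psi ((N / d : ℕ) : ℝ) =
      ∑ n ∈ Finset.Ioc 0 N, ArithmeticFunction.vonMangoldt n * (if d ≤ N / n then 1 else 0) := by
  rw [psi, Nat.floor_natCast]
  simp only [mul_ite, mul_one, mul_zero]
  rw [← Finset.sum_filter]
  refine Finset.sum_congr ?_ fun _ _ => rfl
  ext n
  simp only [Finset.mem_Ioc, Finset.mem_filter]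
  constructor
  · rintro ⟨h0, h1⟩
    refine ⟨⟨h0, h1.trans (Nat.div_le_self N d)⟩, ?_⟩
    rw [Nat.le_div_iff_mul_le hd] at h1
    rwa [Nat.le_div_iff_mul_le h0, mul_comm]
  · rintro ⟨⟨h0, _⟩, h1⟩
    refine ⟨h0, ?_⟩
    rw [Nat.le_div_iff_mul_le h0] at h1
    rwa [Nat.le_div_iff_mul_le hd, mul_comm]

/-- Chebyshev's combination of logarithms of factorials. -/
noncomputable def chebyshevSum (N : ℕ) : ℝ :=
  Real.log N.factorial - Real.log (N / 2).factorial - Real.log (N / 3).factorial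
    - Real.log (N / 5).factorial + Real.log (N / 30).factorial

theorem chebyshevSum_eq (N : ℕ) :
    chebyshevSum N = ∑ n ∈ Finset.Ioc 0 N, ArithmeticFunction.vonMangoldt n *
      (((N / n : ℕ) : ℝ) - (N / n / 2 : ℕ) - (N / n / 3 : ℕ) - (N / n / 5 : ℕ)
        + (N / n / 30 : ℕ)) := by
  rw [chebyshevSum, log_factorial_eq_sum_vonMangoldt, log_factorial_div_eq_sum_vonMangoldt,
    log_factorial_div_eq_sum_vonMangoldt, log_factorial_div_eq_sum_vonMangoldt,
    log_factorial_div_eq_sum_vonMangoldt]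
  simp only [← Finset.sum_sub_distrib, ← Finset.sum_add_distrib]
  exact Finset.sum_congr rfl fun _ _ => by ring

/-- The coefficient y - ⌊y/2⌋ - ⌊y/3⌋ - ⌊y/5⌋ + ⌊y/30⌋ never exceeds 1. -/
theorem chebyshevSum_le_psi (N : ℕ) : chebyshevSum N ≤ psi (N : ℝ) := by
  rw [chebyshevSum_eq, psi, Nat.floor_natCast]
  refine Finset.sum_le_sum fun n _ => ?_
  refine mul_le_of_le_one_right ArithmeticFunction.vonMangoldt_nonneg ?_
  generalize N / n = y
  have h : y + y / 30 ≤ y / 2 + y / 3 + y / 5 + 1 := by omega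
  have h' : (y : ℝ) + (y / 30 : ℕ) ≤ (y / 2 : ℕ) + (y / 3 : ℕ) + (y / 5 : ℕ) + 1 := by
    exact_mod_cast h
  linarith

/-- The same coefficient is nonnegative, and equals 1 for 1 ≤ y ≤ 5 and for 7 ≤ y ≤ 9; the left side
is the indicator of these y. -/
theorem psi_combination_le_chebyshevSum (N : ℕ) :
    psi (N : ℝ) - psi ((N / 6 : ℕ) : ℝ) + psi ((N / 7 : ℕ) : ℝ) - psi ((N / 10 : ℕ) : ℝ)
      ≤ chebyshevSum N := by
  have h1 := psi_div_eq_sum N (d := 1) one_pos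
  rw [Nat.div_one] at h1
  rw [chebyshevSum_eq, h1, psi_div_eq_sum N (by norm_num : 0 < 6),
    psi_div_eq_sum N (by norm_num : 0 < 7), psi_div_eq_sum N (by norm_num : 0 < 10)]
  simp only [← Finset.sum_sub_distrib, ← Finset.sum_add_distrib, ← mul_sub, ← mul_add]
  refine Finset.sum_le_sum fun n _ => ?_
  refine mul_le_mul_of_nonneg_left ?_ ArithmeticFunction.vonMangoldt_nonneg
  generalize N / n = y
  have key : ∀ a b : ℕ, a + (y / 2 + y / 3 + y / 5) ≤ y + y / 30 + b →
      (a : ℝ) - b ≤ (y : ℝ) - (y / 2 : ℕ) - (y / 3 : ℕ) - (y / 5 : ℕ) + (y / 30 : ℕ) := by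
    intro a b h
    have h' : (a : ℝ) + ((y / 2 : ℕ) + (y / 3 : ℕ) + (y / 5 : ℕ)) ≤ y + (y / 30 : ℕ) + b := by
      exact_mod_cast h
    linarith
  have h := key ((if 1 ≤ y then 1 else 0) + (if 7 ≤ y then 1 else 0))
    ((if 6 ≤ y then 1 else 0) + (if 10 ≤ y then 1 else 0)) (by split_ifs <;> omega)
  refine le_trans (le_of_eq ?_) h
  push_cast
  ring

/-- The constant in Chebyshev's estimates. -/
noncomputable def chebyshevConst : ℝ :=
  Real.log 2 / 2 + Real.log 3 / 3 + Real.log 5 / 5 - Real.log 30 / 30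

/-- Because 1 - 1/2 - 1/3 - 1/5 + 1/30 = 0, the x log x and x terms of Stirling's formula cancel,
and only the terms (x/d) log d survive. -/
theorem abs_chebyshevSum_floor_sub_le {x : ℝ} (hx : 30 ≤ x) :
    |chebyshevSum ⌊x⌋₊ - chebyshevConst * x| ≤ 5 * (Real.log x + 1) := by
  have hx0 : 0 < x := by linarith
  have aux : ∀ d : ℕ, 1 ≤ d → (d : ℝ) ≤ 30 →
      |Real.log ((⌊x⌋₊ / d).factorial : ℝ)
        - (x / d * (Real.log x - Real.log d) - x / d)| ≤ Real.log x + 1 := by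
    intro d hd hd'
    have hd0 : (0 : ℝ) < d := by exact_mod_cast hd
    have hd1 : (1 : ℝ) ≤ d := by exact_mod_cast hd
    have h := abs_log_floor_factorial_sub_le (x := x / d) (by rw [le_div_iff₀ hd0]; linarith)
    rw [Nat.floor_div_natCast, Real.log_div hx0.ne' hd0.ne'] at h
    refine h.trans ?_
    have := Real.log_nonneg hd1
    linarith
  have h1 := aux 1 le_rfl (by norm_num)
  have h2 := aux 2 (by norm_num) (by norm_num)
  have h3 := aux 3 (by norm_num) (by norm_num)
  have h5 := aux 5 (by norm_num) (by norm_num)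
  have h30 := aux 30 (by norm_num) (by norm_num)
  rw [Nat.div_one] at h1
  rw [abs_le] at *
  push_cast at *
  simp only [Real.log_one, chebyshevSum, chebyshevConst] at *
  obtain ⟨h1, h1'⟩ := h1
  obtain ⟨h2, h2'⟩ := h2
  obtain ⟨h3, h3'⟩ := h3
  obtain ⟨h5, h5'⟩ := h5
  obtain ⟨h30, h30'⟩ := h30
  constructor <;> linarith

theorem eventually_abs_chebyshevSum_floor_sub_le {ε : ℝ} (hε : 0 < ε) :
    ∀ᶠ x : ℝ in atTop, |chebyshevSum ⌊x⌋₊ - chebyshevConst * x| ≤ ε * x := by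
  have h1 : ∀ᶠ x : ℝ in atTop, ‖Real.log x‖ ≤ ε / 10 * ‖x‖ :=
    Real.isLittleO_log_id_atTop.bound (by positivity)
  filter_upwards [h1, eventually_ge_atTop 30, eventually_ge_atTop (10 / ε)] with x h hx hx'
  refine (abs_chebyshevSum_floor_sub_le hx).trans ?_
  rw [Real.norm_of_nonneg (Real.log_nonneg (by linarith)), Real.norm_of_nonneg (by linarith)] at h
  rw [div_le_iff₀ hε] at hx'
  nlinarith

theorem eventually_le_psi {a : ℝ} (ha : a < chebyshevConst) :
    ∀ᶠ x : ℝ in atTop, a * x ≤ psi x := by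
  filter_upwards [eventually_abs_chebyshevSum_floor_sub_le (sub_pos.2 ha)] with x h
  have h2 := chebyshevSum_le_psi ⌊x⌋₊
  rw [← psi_eq_psi_coe_floor] at h2
  have := (abs_le.1 h).1
  nlinarith

/-- An eventual linear upper bound for `ψ` improves itself. -/
theorem eventually_psi_le_of_eventually_psi_le {a b c : ℝ} (ha : a < chebyshevConst)
    (hc : chebyshevConst < c) (hb : ∀ᶠ x : ℝ in atTop, psi x ≤ b * x) :
    ∀ᶠ x : ℝ in atTop, psi x ≤ (c - a / 7 + b * (4 / 15)) * x := by
  have hdiv : ∀ d : ℝ, 0 < d → Tendsto (fun x : ℝ => x / d) atTop atTop := fun d hd =>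
    tendsto_id.atTop_div_const hd
  filter_upwards [eventually_abs_chebyshevSum_floor_sub_le (sub_pos.2 hc),
    (hdiv 7 (by norm_num)).eventually (eventually_le_psi ha),
    (hdiv 6 (by norm_num)).eventually hb, (hdiv 10 (by norm_num)).eventually hb]
    with x h h7 h6 h10
  -- Solve for ψ(x): ψ(x/6) and ψ(x/10) cost b(1/6 + 1/10) = 4b/15, and the lower bound for ψ(x/7)
  -- gains a/7.
  have h2 := psi_combination_le_chebyshevSum ⌊x⌋₊
  have hfl : ∀ d : ℕ, psi ((⌊x⌋₊ / d : ℕ) : ℝ) = psi (x / d) := fun d => by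
    rw [psi_eq_psi_coe_floor (x / d), Nat.floor_div_natCast]
  rw [← psi_eq_psi_coe_floor, hfl, hfl, hfl] at h2
  have := (abs_le.1 h).2
  push_cast at h2
  linarith

theorem lt_chebyshevConst : (0.9212 : ℝ) < chebyshevConst := by
  have h30 : Real.log 30 = Real.log 2 + Real.log 3 + Real.log 5 := by
    rw [← Real.log_mul (by norm_num) (by norm_num), ← Real.log_mul (by norm_num) (by norm_num)]
    norm_num
  rw [chebyshevConst, h30]
  linarith [Real.log_two_gt_d9, Real.log_three_gt_d9, Real.log_five_gt_d9]

theorem chebyshevConst_lt : chebyshevConst < (0.9213 : ℝ) := by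
  have h30 : Real.log 30 = Real.log 2 + Real.log 3 + Real.log 5 := by
    rw [← Real.log_mul (by norm_num) (by norm_num), ← Real.log_mul (by norm_num) (by norm_num)]
    norm_num
  rw [chebyshevConst, h30]
  linarith [Real.log_two_lt_d9, Real.log_three_lt_d9, Real.log_five_lt_d9]

theorem eventually_psi_le : ∀ᶠ x : ℝ in atTop, psi x ≤ 1.08 * x := by
  have hlog4 : Real.log 4 < 1.3864 := by
    rw [show (4 : ℝ) = 2 ^ 2 by norm_num, Real.log_pow]
    have := Real.log_two_lt_d9
    push_cast; linarith
  have h0 : ∀ᶠ x : ℝ in atTop, psi x ≤ 1.4 * x := by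
    have h1 : ∀ᶠ x : ℝ in atTop, ‖Real.log x‖ ≤ 0.001 * ‖x ^ (1 / 2 : ℝ)‖ :=
      (isLittleO_log_rpow_atTop (by norm_num)).bound (by positivity)
    filter_upwards [h1, eventually_ge_atTop 1] with x h hx
    have h2 := psi_le hx
    rw [Real.norm_of_nonneg (Real.log_nonneg hx), ← Real.sqrt_eq_rpow,
      Real.norm_of_nonneg (Real.sqrt_nonneg x)] at h
    have h3 : 2 * √x * Real.log x ≤ 2 * √x * (0.001 * √x) := by gcongr
    have h4 : √x * √x = x := Real.mul_self_sqrt (by linarith)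
    nlinarith
  have step := fun b => eventually_psi_le_of_eventually_psi_le (b := b) lt_chebyshevConst
    chebyshevConst_lt
  -- The map b ↦ c - a/7 + 4b/15 contracts to a fixed point near 1.077; five iterations from 1.4 get
  -- below 1.08.
  have h5 := step _ (step _ (step _ (step _ (step _ h0))))
  filter_upwards [h5, eventually_ge_atTop 0] with x h hx
  refine h.trans (mul_le_mul_of_nonneg_right ?_ hx)
  norm_num

end Chebyshev

open Chebyshev in
/-- For large `x` there is a prime in `(x, 1.1735 x]`. -/
theorem eventually_exists_prime_mem_Ioc :
    ∀ᶠ x : ℝ in atTop, ∃ p : ℕ, p.Prime ∧ x < p ∧ p ≤ 1.1735 * x := by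
  obtain ⟨C, hC⟩ := psi_sub_theta_le_mul_sqrt
  have hscale : Tendsto (fun x : ℝ => 1.1735 * x) atTop atTop :=
    tendsto_id.const_mul_atTop (by norm_num)
  -- Without a prime, θ would not grow between x and 1.1735 x. Since 0.9212 · 1.1735 > 1.08 + 0.0008
  -- · 1.1735, a gap ψ - θ of this size still gives a contradiction.
  have h1 : ∀ᶠ x : ℝ in atTop, C * √x < 0.0008 * x := by
    have h2 : Tendsto (fun x : ℝ => √x) atTop atTop := Real.tendsto_sqrt_atTop
    filter_upwards [h2.eventually_gt_atTop (C / 0.0008), eventually_gt_atTop 0] with x h hx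
    rw [div_lt_iff₀ (by norm_num)] at h
    have h4 : √x * √x = x := Real.mul_self_sqrt hx.le
    have h5 : 0 < √x := Real.sqrt_pos.2 hx
    nlinarith
  filter_upwards [hscale.eventually (eventually_le_psi lt_chebyshevConst), eventually_psi_le,
    hscale.eventually h1, eventually_gt_atTop 0] with x hlo hup hs hx
  by_contra! hcon
  have hth : theta (1.1735 * x) ≤ theta x := by
    rw [theta, theta]
    refine Finset.sum_le_sum_of_subset_of_nonneg ?_ fun p hp _ => Real.log_natCast_nonneg p
    intro p hp
    simp only [Finset.mem_filter, Finset.mem_Ioc] at hp ⊢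
    refine ⟨⟨hp.1.1, ?_⟩, hp.2⟩
    have hp2 : (p : ℝ) ≤ 1.1735 * x := (Nat.le_floor_iff (by positivity)).1 hp.1.2
    by_contra hlt
    have hlt' : x < p := by
      by_contra hle
      exact hlt (Nat.le_floor (not_lt.1 hle))
    exact absurd (hcon p hp.2 hlt') (not_lt.2 hp2)
  have h6 := hC (1.1735 * x)
  have h7 := theta_le_psi x
  linarith

/-! ### Independent sets of `{-1, 0, 1}`-vectors: the polynomial method -/

namespace SignVector

variable {n : ℕ}

/-- The dot product of two sign vectors, in a ring. -/
def dot (R : Type*) [CommRing R] (x y : Fin n → SignType) : R := ∑ i, (x i : R) * (y i : R)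

/-- The monomial function with exponents in `{0, 1, 2}` on sign vectors. -/
def monomial (R : Type*) [CommRing R] (e : Fin n → Fin 3) (y : Fin n → SignType) : R :=
  ∏ i, (y i : R) ^ (e i : ℕ)

/-- Exponent vectors of reduced monomials of degree at most `k`. -/
def exponents (n k : ℕ) : Finset (Fin n → Fin 3) := {e | ∑ i, (e i : ℕ) ≤ k}

/-- The functions on sign vectors given by polynomials of degree at most `k`. -/
def polys (R : Type*) [CommRing R] (n k : ℕ) : Submodule R ((Fin n → SignType) → R) :=
  Submodule.span R (monomial R '' (exponents n k : Set (Fin n → Fin 3)))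

theorem polys_mono (R : Type*) [CommRing R] (n : ℕ) {k l : ℕ} (h : k ≤ l) :
    polys R n k ≤ polys R n l := by
  refine Submodule.span_mono (Set.image_mono fun e he => ?_)
  simp only [exponents, Finset.coe_filter, Finset.mem_univ, true_and, Set.mem_ofPred_eq] at he ⊢
  omega

theorem monomial_mem_polys (R : Type*) [CommRing R] {k : ℕ} {e : Fin n → Fin 3}
    (he : ∑ i, (e i : ℕ) ≤ k) : monomial R e ∈ polys R n k :=
  Submodule.subset_span ⟨e, by simpa [exponents] using he, rfl⟩

/-- Reduction by s³ = s on {-1, 0, 1} keeps exponents at most 2 without raising the degree. -/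
theorem coord_mul_monomial_mem_polys (R : Type*) [CommRing R] {k : ℕ} {e : Fin n → Fin 3}
    (he : ∑ i, (e i : ℕ) ≤ k) (i : Fin n) :
    (fun y => (y i : R) * monomial R e y) ∈ polys R n (k + 1) := by
  obtain ⟨f, hf, hsum⟩ : ∃ f : Fin 3, (∀ s : SignType, (s : R) * (s : R) ^ (e i : ℕ) =
      (s : R) ^ (f : ℕ)) ∧ (f : ℕ) ≤ e i + 1 := by
    generalize e i = a
    fin_cases a
    · exact ⟨1, fun s => by simp, by simp⟩
    · exact ⟨2, fun s => by simp; ring, by simp⟩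
    · exact ⟨1, fun s => by cases s <;> simp, by simp⟩
  have heq : (fun y => (y i : R) * monomial R e y) = monomial R (Function.update e i f) := by
    funext y
    simp only [monomial]
    rw [← Finset.mul_prod_erase _ _ (Finset.mem_univ i), ← mul_assoc, hf,
      ← Finset.mul_prod_erase _ (fun j => (y j : R) ^ ((Function.update e i f j : Fin 3) : ℕ))
        (Finset.mem_univ i)]
    congr 1
    · simp
    · refine Finset.prod_congr rfl fun j hj => ?_
      rw [Function.update_of_ne (Finset.ne_of_mem_erase hj)]
  rw [heq]
  refine monomial_mem_polys R ?_
  rw [← Finset.add_sum_erase _ _ (Finset.mem_univ i)] at he ⊢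
  have : ∑ j ∈ Finset.univ.erase i, ((Function.update e i f j : Fin 3) : ℕ) =
      ∑ j ∈ Finset.univ.erase i, (e j : ℕ) :=
    Finset.sum_congr rfl fun j hj => by rw [Function.update_of_ne (Finset.ne_of_mem_erase hj)]
  rw [this]
  simp only [Function.update_self]
  omega

theorem coord_mul_mem_polys (R : Type*) [CommRing R] {k : ℕ} {φ : (Fin n → SignType) → R}
    (hφ : φ ∈ polys R n k) (i : Fin n) : (fun y => (y i : R) * φ y) ∈ polys R n (k + 1) := by
  induction hφ using Submodule.span_induction with
  | mem φ h =>
    obtain ⟨e, he, rfl⟩ := h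
    exact coord_mul_monomial_mem_polys R (by simpa [exponents] using he) i
  | zero =>
    simp only [Pi.zero_apply, mul_zero]
    exact (polys R n (k + 1)).zero_mem
  | add φ ψ _ _ h1 h2 =>
    convert! (polys R n (k + 1)).add_mem h1 h2 using 1
    funext y; simp [mul_add]
  | smul c φ _ h =>
    convert! (polys R n (k + 1)).smul_mem c h using 1
    funext y; simp [mul_left_comm]

theorem affine_mul_mem_polys (R : Type*) [CommRing R] {k : ℕ} {φ : (Fin n → SignType) → R}
    (hφ : φ ∈ polys R n k) (x : Fin n → SignType) (c : R) :
    (fun y => (dot R x y + c) * φ y) ∈ polys R n (k + 1) := by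
  have h1 : (∑ i, (x i : R) • fun y : Fin n → SignType => (y i : R) * φ y) ∈ polys R n (k + 1) :=
    Submodule.sum_mem _ fun i _ => Submodule.smul_mem _ _ (coord_mul_mem_polys R hφ i)
  have h2 : c • φ ∈ polys R n (k + 1) :=
    Submodule.smul_mem _ _ (polys_mono R n (Nat.le_succ k) hφ)
  convert! Submodule.add_mem _ h1 h2 using 1
  funext y
  simp [dot, add_mul, Finset.sum_mul, Finset.sum_apply, mul_assoc]

theorem prod_affine_mem_polys (R : Type*) [CommRing R] (x : Fin n → SignType) (c : ℕ → R)
    (k : ℕ) : (fun y => ∏ j ∈ Finset.range k, (dot R x y + c j)) ∈ polys R n k := by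
  induction k with
  | zero =>
    have := monomial_mem_polys R (n := n) (k := 0) (e := 0) (by simp)
    convert! this using 1
    funext y; simp [monomial]
  | succ k ih =>
    convert! affine_mul_mem_polys R ih x (c k) using 1
    funext y
    rw [Finset.prod_range_succ, mul_comm]

theorem dot_comm (R : Type*) [CommRing R] (x y : Fin n → SignType) : dot R x y = dot R y x :=
  Finset.sum_congr rfl fun _ _ => mul_comm _ _

theorem dot_self (x : Fin n → SignType) :
    dot ℤ x x = (Finset.univ.filter fun i => x i ≠ 0).card := by
  rw [dot, Finset.card_filter, Nat.cast_sum]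
  refine Finset.sum_congr rfl fun i _ => ?_
  cases x i <;> simp

theorem intCast_dot (R : Type*) [CommRing R] (x y : Fin n → SignType) :
    ((dot ℤ x y : ℤ) : R) = dot R x y := by
  simp only [dot, Int.cast_sum, Int.cast_mul]
  refine Finset.sum_congr rfl fun i _ => ?_
  cases x i <;> cases y i <;> simp

/-- Cauchy–Schwarz for sign vectors of equal weight, with the equality case. -/
theorem abs_dot_le {x y : Fin n → SignType} {k : ℕ} (hx : dot ℤ x x = k) (hy : dot ℤ y y = k) :
    -(k : ℤ) ≤ dot ℤ x y ∧ dot ℤ x y ≤ k ∧ (dot ℤ x y = k → x = y) := by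
  have h1 : ∑ i, ((x i : ℤ) - (y i : ℤ)) ^ 2 = 2 * k - 2 * dot ℤ x y := by
    have : ∑ i, ((x i : ℤ) - (y i : ℤ)) ^ 2 = dot ℤ x x + dot ℤ y y - 2 * dot ℤ x y := by
      simp only [dot, Finset.mul_sum, ← Finset.sum_add_distrib, ← Finset.sum_sub_distrib]
      exact Finset.sum_congr rfl fun _ _ => by ring
    rw [this, hx, hy]; ring
  have h2 : ∑ i, ((x i : ℤ) + (y i : ℤ)) ^ 2 = 2 * k + 2 * dot ℤ x y := by
    have : ∑ i, ((x i : ℤ) + (y i : ℤ)) ^ 2 = dot ℤ x x + dot ℤ y y + 2 * dot ℤ x y := by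
      simp only [dot, Finset.mul_sum, ← Finset.sum_add_distrib]
      exact Finset.sum_congr rfl fun _ _ => by ring
    rw [this, hx, hy]; ring
  have h1' : 0 ≤ ∑ i, ((x i : ℤ) - (y i : ℤ)) ^ 2 := Finset.sum_nonneg fun _ _ => sq_nonneg _
  have h2' : 0 ≤ ∑ i, ((x i : ℤ) + (y i : ℤ)) ^ 2 := Finset.sum_nonneg fun _ _ => sq_nonneg _
  refine ⟨by linarith, by linarith, fun h => ?_⟩
  rw [h, sub_self, Finset.sum_eq_zero_iff_of_nonneg fun _ _ => sq_nonneg _] at h1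
  funext i
  have h3 := h1 i (Finset.mem_univ i)
  rw [sq_eq_zero_iff, sub_eq_zero] at h3
  revert h3
  cases x i <;> cases y i <;> simp

/-- A family of sign vectors of weight `p - 1`, no two of which have inner product `-1`,
is at most as large as the space of reduced polynomials of degree `p - 1`. -/
theorem card_le_card_exponents {p : ℕ} [hp : Fact p.Prime] {F : Finset (Fin n → SignType)}
    (hF : ∀ x ∈ F, dot ℤ x x = (p - 1 : ℕ)) (hind : ∀ x ∈ F, ∀ y ∈ F, dot ℤ x y ≠ -1) :
    F.card ≤ (exponents n (p - 1)).card := by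
  classical
  have hp1 : 1 ≤ p := hp.out.one_le
  let res : ((Fin n → SignType) → ZMod p) →ₗ[ZMod p] (F → ZMod p) :=
    LinearMap.funLeft (ZMod p) (ZMod p) Subtype.val
  let W : Submodule (ZMod p) (F → ZMod p) := (polys (ZMod p) n (p - 1)).map res
  -- The factors are ⟨x,y⟩ - j for 0 ≤ j ≤ p - 2, so the product vanishes mod p unless ⟨x,y⟩ ≡ -1.
  -- With -1 itself excluded, only ⟨x,y⟩ = p - 1, that is x = y, remains.
  have hval : ∀ x y : F, (∏ j ∈ Finset.range (p - 1),
      (dot (ZMod p) x.1 y.1 + (1 - (j + 1 : ℕ) : ZMod p))) ≠ 0 ↔ x = y := by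
    intro x y
    obtain ⟨hlo, hhi, heq⟩ := abs_dot_le (hF x x.2) (hF y y.2)
    rw [Nat.cast_sub hp1] at hlo hhi heq
    constructor
    · intro h
      by_contra hne
      apply h
      have hne' : dot ℤ x.1 y.1 ≠ (p : ℤ) - 1 := fun h' => hne (Subtype.ext (heq (by simpa using h')))
      have hne1 := hind x x.2 y y.2
      obtain ⟨j, hj, hdvd⟩ : ∃ j ∈ Finset.range (p - 1),
          (p : ℤ) ∣ dot ℤ x.1 y.1 + (1 - (j + 1 : ℕ)) := by
        push_cast at hlo hhi hne'
        set s := dot ℤ x.1 y.1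
        rcases le_or_gt 0 s with hs | hs
        · refine ⟨s.toNat, Finset.mem_range.2 (by omega), ?_⟩
          have : s + (1 - ((s.toNat + 1 : ℕ) : ℤ)) = 0 := by push_cast; omega
          rw [this]; exact dvd_zero _
        · refine ⟨(s + p).toNat, Finset.mem_range.2 (by omega), ?_⟩
          have : s + (1 - (((s + p).toNat + 1 : ℕ) : ℤ)) = -p := by push_cast; omega
          rw [this]; exact (dvd_refl _).neg_right
      refine Finset.prod_eq_zero hj ?_
      rw [← ZMod.intCast_zmod_eq_zero_iff_dvd] at hdvd
      push_cast [intCast_dot] at hdvd ⊢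
      exact hdvd
    · rintro rfl
      rw [Finset.prod_ne_zero_iff]
      intro j hj
      rw [Finset.mem_range] at hj
      rw [← intCast_dot, hF x x.2]
      have : (((p - 1 : ℕ) : ℤ) : ZMod p) + (1 - (j + 1 : ℕ)) = -((j + 1 : ℕ) : ZMod p) := by
        rw [Nat.cast_sub hp1]; push_cast; simp
      rw [this, neg_ne_zero, Ne, ZMod.natCast_eq_zero_iff]
      exact fun h => absurd (Nat.le_of_dvd (by omega) h) (by omega)
  -- Scaled by its diagonal value, the polynomial of x restricts to the indicator of x on F, so the
  -- restrictions span all functions on F.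
  have hW : W = ⊤ := by
    rw [eq_top_iff, ← (Pi.basisFun (ZMod p) F).span_eq, Submodule.span_le]
    rintro _ ⟨x, rfl⟩
    rw [Pi.basisFun_apply]
    have hx := hval x x
    simp only [iff_true] at hx
    set a := ∏ j ∈ Finset.range (p - 1), (dot (ZMod p) x.1 x.1 + (1 - (j + 1 : ℕ) : ZMod p))
      with ha
    have hmem : res (fun y => ∏ j ∈ Finset.range (p - 1),
        (dot (ZMod p) x.1 y + (1 - (j + 1 : ℕ) : ZMod p))) ∈ W :=
      Submodule.mem_map_of_mem (prod_affine_mem_polys _ _ _ _)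
    have := W.smul_mem a⁻¹ hmem
    convert! this using 1
    funext y
    rcases eq_or_ne x y with rfl | hxy
    · simp only [Pi.single_eq_same, Pi.smul_apply, res, LinearMap.funLeft_apply, smul_eq_mul]
      rw [← ha, inv_mul_cancel₀ hx]
    · have h0 := (hval x y).not.2 hxy
      rw [not_not] at h0
      simp only [Pi.smul_apply, res, LinearMap.funLeft_apply, h0, smul_zero]
      rw [Pi.single_eq_of_ne hxy.symm]
  have h1 : Module.finrank (ZMod p) W = F.card := by
    rw [hW, finrank_top, Module.finrank_fintype_fun_eq_card, Fintype.card_coe]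
  rw [← h1]
  have h2 : W = Submodule.span (ZMod p)
      (((exponents n (p - 1)).image fun e => res (monomial (ZMod p) e) : Finset _) :
        Set (F → ZMod p)) := by
    simp only [W, polys, Submodule.map_span, Finset.coe_image, Set.image_image]
  rw [h2]
  exact (finrank_span_finset_le_card _).trans Finset.card_image_le

/-- Exponential-moment bound for the number of reduced monomials. -/
theorem card_exponents_mul_pow_le (n k : ℕ) {t : ℝ} (ht : 0 ≤ t) (ht1 : t ≤ 1) :
    ((exponents n k).card : ℝ) * t ^ k ≤ (1 + t + t ^ 2) ^ n := by
  have h1 : (1 + t + t ^ 2) ^ n = ∑ e : Fin n → Fin 3, t ^ ∑ i, (e i : ℕ) := by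
    simp only [← Finset.prod_pow_eq_pow_sum]
    rw [← Fintype.prod_sum fun (_ : Fin n) (a : Fin 3) => t ^ (a : ℕ)]
    simp [Fin.sum_univ_three]
  rw [h1, ← nsmul_eq_mul, ← Finset.sum_const]
  refine (Finset.sum_le_sum fun e he => ?_).trans
    (Finset.sum_le_sum_of_subset_of_nonneg (Finset.subset_univ _) fun _ _ _ => by positivity)
  exact pow_le_pow_of_le_one ht ht1 (by simpa [exponents] using he)

/-- Sign vectors of weight `k`. -/
def ofWeight (n k : ℕ) : Finset (Fin n → SignType) :=
  {x | (Finset.univ.filter fun i => x i ≠ 0).card = k}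

theorem choose_mul_two_pow_le_card_ofWeight (n k : ℕ) :
    n.choose k * 2 ^ k ≤ (ofWeight n k).card := by
  classical
  have hsub : ((Finset.univ : Finset (Fin n)).powersetCard k).biUnion (fun S =>
      Fintype.piFinset fun i => if i ∈ S then ({1, -1} : Finset SignType) else {0})
      ⊆ ofWeight n k := by
    intro x hx
    simp only [Finset.mem_biUnion, Finset.mem_powersetCard, Fintype.mem_piFinset] at hx
    obtain ⟨S, ⟨-, hS⟩, hx⟩ := hx
    have : (Finset.univ.filter fun i => x i ≠ 0) = S := by
      ext i
      have := hx i
      by_cases hi : i ∈ S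
      · simp only [hi, if_true, Finset.mem_insert, Finset.mem_singleton] at this
        rcases this with h | h <;> simp [h, hi]
      · simp only [hi, if_false, Finset.mem_singleton] at this
        simp [this, hi]
    simp [ofWeight, this, hS]
  refine le_trans (le_of_eq ?_) (Finset.card_le_card hsub)
  rw [Finset.card_biUnion]
  · rw [Finset.sum_congr rfl (g := fun _ => 2 ^ k)]
    · simp
    · intro S hS
      rw [Finset.mem_powersetCard] at hS
      rw [Fintype.card_piFinset, ← hS.2, ← Finset.prod_const, ← Finset.prod_subset hS.1]
      · exact Finset.prod_congr rfl fun i hi => by simp [hi]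
      · intro i _ hi; simp [hi]
  · intro S hS T hT hST
    rw [Function.onFun, Finset.disjoint_left]
    intro x hx hx'
    apply hST
    rw [Fintype.mem_piFinset] at hx hx'
    ext i
    have h1 := hx i
    have h2 := hx' i
    by_cases hi : i ∈ S <;> by_cases hj : i ∈ T <;> simp_all

/-- The graph on sign vectors of weight `k` whose edges are the pairs with inner product `-1`. -/
def graph (n k : ℕ) : SimpleGraph (ofWeight n k) where
  Adj x y := dot ℤ x.1 y.1 = -1
  symm := ⟨fun x y h => by rwa [dot_comm]⟩
  loopless := ⟨fun x h => by
    rw [dot_self] at h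
    omega⟩

/-- Each color class is independent, so the polynomial bound applies to it. -/
theorem card_le_of_graph_colorable {p c : ℕ} [Fact p.Prime]
    (h : (graph n (p - 1)).Colorable c) :
    (ofWeight n (p - 1)).card ≤ c * (exponents n (p - 1)).card := by
  classical
  obtain ⟨f⟩ := h
  have h1 := Finset.card_le_mul_card_image_of_maps_to (s := (Finset.univ : Finset (ofWeight n (p - 1))))
    (t := (Finset.univ : Finset (Fin c))) (f := f) (fun _ _ => Finset.mem_univ _)
    (exponents n (p - 1)).card (fun a _ => ?_)
  · simpa [mul_comm] using h1
  · rw [← Finset.card_map (Function.Embedding.subtype _)]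
    refine card_le_card_exponents ?_ ?_
    · intro x hx
      simp only [Finset.mem_map, Finset.mem_filter] at hx
      obtain ⟨x, -, rfl⟩ := hx
      have := x.2
      simp only [ofWeight, Finset.mem_filter] at this
      exact (dot_self _).trans (congrArg _ this.2)
    · intro x hx y hy hxy
      simp only [Finset.mem_map, Finset.mem_filter, Finset.mem_univ, true_and] at hx hy
      obtain ⟨x, hx, rfl⟩ := hx
      obtain ⟨y, hy, rfl⟩ := hy
      exact f.valid (v := x) (w := y) hxy (hx.trans hy.symm)

end SignVector

/-! ### Entropy estimates -/

/-- The entropy lower bound for binomial coefficients. -/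
theorem Nat.one_le_succ_mul_choose_mul {n k : ℕ} (hk : k < n) :
    1 ≤ ((n : ℝ) + 1) * (n.choose k * ((k / n : ℝ) ^ k * (1 - k / n : ℝ) ^ (n - k))) := by
  have hn0 : (0 : ℝ) < n := by exact_mod_cast (Nat.zero_le k).trans_lt hk
  set q : ℝ := k / n with hq
  have hkn : (k : ℝ) < n := by exact_mod_cast hk
  have hq0 : 0 ≤ q := by positivity
  have hq1 : 0 < 1 - q := by rw [hq, sub_pos, div_lt_one hn0]; exact hkn
  -- The binomial distribution with success probability k/n has its mode at k, and its n + 1 terms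
  -- sum to 1.
  set b : ℕ → ℝ := fun j => n.choose j * (q ^ j * (1 - q) ^ (n - j)) with hb
  have hsum : ∑ j ∈ Finset.range (n + 1), b j = 1 := by
    have := add_pow q (1 - q) n
    rw [add_sub_cancel, one_pow] at this
    rw [this]
    exact Finset.sum_congr rfl fun j _ => by simp only [hb]; ring
  have hnq : n * q = k := by rw [hq]; field_simp
  -- the ratio of consecutive terms
  have hratio : ∀ j, j < n → (j + 1) * ((1 - q) * b (j + 1)) = (n - j) * (q * b j) := by
    intro j hj
    have h1 := Nat.choose_succ_right_eq n j
    have h1' : (n.choose (j + 1) : ℝ) * (j + 1) = n.choose j * (n - j) := by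
      rw [← Nat.cast_sub hj.le]; exact_mod_cast h1
    have h2 : n - j = (n - (j + 1)) + 1 := by omega
    simp only [hb]
    rw [h2, pow_succ, pow_succ]
    linear_combination q ^ j * q * (1 - q) ^ (n - (j + 1)) * (1 - q) * h1'
  have hb0 : ∀ j, 0 ≤ b j := fun j => by
    simp only [hb]; positivity
  have hmax : ∀ j ∈ Finset.range (n + 1), b j ≤ b k := by
    have hup : ∀ j, j < k → b j ≤ b (j + 1) := by
      intro j hj
      have h := hratio j (hj.trans hk)
      have hj' : (j : ℝ) + 1 ≤ k := by exact_mod_cast hj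
      have hc : ((j : ℝ) + 1) * (1 - q) ≤ (n - j) * q := by nlinarith
      refine le_of_mul_le_mul_left ?_ (show 0 < ((j : ℝ) + 1) * (1 - q) by positivity)
      nlinarith [mul_le_mul_of_nonneg_right hc (hb0 j)]
    have hdown : ∀ j, k ≤ j → j < n → b (j + 1) ≤ b j := by
      intro j hj hjn
      have h := hratio j hjn
      have hj' : (k : ℝ) ≤ j := by exact_mod_cast hj
      have hc : (n - j) * q ≤ ((j : ℝ) + 1) * (1 - q) := by nlinarith
      refine le_of_mul_le_mul_left ?_ (show 0 < ((j : ℝ) + 1) * (1 - q) by positivity)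
      nlinarith [mul_le_mul_of_nonneg_right hc (hb0 j)]
    intro j hj
    rcases le_total j k with h | h
    · exact Nat.decreasingInduction' (P := fun i => b i ≤ b k)
        (fun i hi _ ih => (hup i hi).trans ih) h le_rfl
    · have hjn : j ≤ n := Nat.lt_succ_iff.1 (Finset.mem_range.1 hj)
      clear hj
      induction j, h using Nat.le_induction with
      | base => exact le_rfl
      | succ i hi ih => exact (hdown i hi (by omega)).trans (ih (by omega))
  have := Finset.sum_le_card_nsmul _ _ _ hmax
  rw [hsum, Finset.card_range, nsmul_eq_mul] at this
  push_cast at this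
  exact this

theorem Nat.exp_mul_binEntropy_le {n k : ℕ} (hk0 : 0 < k) (hk : k < n) :
    Real.exp (n * Real.binEntropy (k / n)) ≤ ((n : ℝ) + 1) * n.choose k := by
  have hn0 : (0 : ℝ) < n := by exact_mod_cast (Nat.zero_le k).trans_lt hk
  have hk0' : (0 : ℝ) < k := by exact_mod_cast hk0
  have hkn : (k : ℝ) < n := by exact_mod_cast hk
  have hq0 : (0 : ℝ) < k / n := by positivity
  have hq1 : (0 : ℝ) < 1 - k / n := by rw [sub_pos, div_lt_one hn0]; exact hkn
  have h := Nat.one_le_succ_mul_choose_mul hk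
  have heq : (k / n : ℝ) ^ k * (1 - k / n : ℝ) ^ (n - k)
      = Real.exp (-(n * Real.binEntropy (k / n))) := by
    rw [← Real.exp_log (pow_pos hq0 k), ← Real.exp_log (pow_pos hq1 (n - k)), ← Real.exp_add,
      Real.log_pow, Real.log_pow, Nat.cast_sub hk.le, Real.binEntropy, Real.log_inv, Real.log_inv]
    congr 1
    field_simp
    ring
  rw [heq, Real.exp_neg, ← mul_assoc, ← div_eq_mul_inv, le_div_iff₀ (Real.exp_pos _),
    one_mul] at h
  exact h

/-- The exponential rate of `C(n, k) (2t) ^ k / (1 + t + t ^ 2) ^ n` for `k = κ n`. -/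
noncomputable def signRate (t κ : ℝ) : ℝ :=
  Real.binEntropy κ + κ * Real.log (2 * t) - Real.log (1 + t + t ^ 2)

/-- Concavity in κ reduces a lower bound on an interval to its two endpoints. -/
theorem concaveOn_signRate (t : ℝ) : ConcaveOn ℝ (Set.Icc 0 1) (signRate t) := by
  unfold signRate
  refine (Real.strictConcave_binEntropy.concaveOn.add ?_).sub (convexOn_const _ (convex_Icc 0 1))
  refine ⟨convex_Icc 0 1, fun x _ y _ a b _ _ _ => le_of_eq ?_⟩
  simp only [smul_eq_mul]
  ring

/-- At a rational κ, exponentiating b times the rate leaves an inequality between rational powers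
that `norm_num` can decide. -/
theorem log_le_signRate {a b : ℕ} {t r : ℝ} (ha : 0 < a) (hab : a < b) (ht : 0 < t) (hr : 0 < r)
    (h : r ^ b * (1 + t + t ^ 2) ^ b * ((a : ℝ) ^ a * ((b : ℝ) - a) ^ (b - a)) ≤
      (b : ℝ) ^ b * (2 * t) ^ a) : Real.log r ≤ signRate t (a / b) := by
  have ha0 : (0 : ℝ) < a := by exact_mod_cast ha
  have hab' : (0 : ℝ) < b - a := sub_pos.2 (by exact_mod_cast hab)
  have hb0 : (0 : ℝ) < b := by linarith
  have h2 := Real.log_le_log (by positivity) h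
  rw [Real.log_mul (by positivity) (by positivity), Real.log_mul (by positivity) (by positivity),
    Real.log_mul (by positivity) (by positivity), Real.log_mul (by positivity) (by positivity)] at h2
  simp only [Real.log_pow] at h2
  rw [Nat.cast_sub hab.le] at h2
  have h3 : 1 - (a : ℝ) / b = (b - a) / b := by field_simp
  rw [signRate, Real.binEntropy, h3, inv_div, inv_div, Real.log_div hb0.ne' ha0.ne',
    Real.log_div hb0.ne' hab'.ne']
  refine le_of_mul_le_mul_left ?_ hb0
  have h4 : (b : ℝ) * ((a : ℝ) / b * (Real.log b - Real.log a)
      + (b - a) / b * (Real.log b - Real.log (b - a)) + a / b * Real.log (2 * t)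
      - Real.log (1 + t + t ^ 2)) = a * (Real.log b - Real.log a)
      + (b - a) * (Real.log b - Real.log (b - a)) + a * Real.log (2 * t)
      - b * Real.log (1 + t + t ^ 2) := by field_simp
  rw [h4]
  linarith

theorem exists_log_le_signRate {κ : ℝ} (h1 : 7 / 18 ≤ κ) (h2 : κ ≤ 21 / 46) :
    ∃ t : ℝ, 0 < t ∧ t ≤ 1 ∧ Real.log 1.1535 ≤ signRate t κ := by
  have key : ∀ {t : ℝ} {a b a' b' : ℕ}, 0 < t → 0 < a → a < b → 0 < a' → a' < b' →
      (1.1535 : ℝ) ^ b * (1 + t + t ^ 2) ^ b * ((a : ℝ) ^ a * ((b : ℝ) - a) ^ (b - a)) ≤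
        (b : ℝ) ^ b * (2 * t) ^ a →
      (1.1535 : ℝ) ^ b' * (1 + t + t ^ 2) ^ b' * ((a' : ℝ) ^ a' * ((b' : ℝ) - a') ^ (b' - a')) ≤
        (b' : ℝ) ^ b' * (2 * t) ^ a' →
      (a / b : ℝ) ≤ κ → κ ≤ a' / b' → Real.log 1.1535 ≤ signRate t κ := by
    intro t a b a' b' ht ha hab ha' hab' h h' hl hu
    have h3 := log_le_signRate ha hab ht (by norm_num) h
    have h4 := log_le_signRate ha' hab' ht (by norm_num) h'
    have m : ∀ {a b : ℕ}, 0 < a → a < b → (a / b : ℝ) ∈ Set.Icc (0 : ℝ) 1 := fun {a b} ha hab =>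
      ⟨by positivity, div_le_one_of_le₀ (by exact_mod_cast hab.le) (by positivity)⟩
    exact (le_min h3 h4).trans ((concaveOn_signRate t).min_le_of_mem_Icc (m ha hab) (m ha' hab')
      ⟨hl, hu⟩)
  -- No single t is used for the whole window. On each of three pieces t is a simple fraction near
  -- the maximizer, where κ = (t + 2t²)/(1 + t + t²).
  rcases le_total κ (2 / 5) with h3 | h3
  · refine ⟨1 / 3, by norm_num, by norm_num, key (a := 7) (b := 18) (a' := 2) (b' := 5)
      (by norm_num) (by norm_num) (by norm_num) (by norm_num) (by norm_num) ?_ ?_ ?_ ?_⟩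
      <;> norm_num <;> linarith
  rcases le_total κ (7 / 16) with h4 | h4
  · refine ⟨4 / 11, by norm_num, by norm_num, key (a := 2) (b := 5) (a' := 7) (b' := 16)
      (by norm_num) (by norm_num) (by norm_num) (by norm_num) (by norm_num) ?_ ?_ ?_ ?_⟩
      <;> norm_num <;> linarith
  · refine ⟨2 / 5, by norm_num, by norm_num, key (a := 7) (b := 16) (a' := 21) (b' := 46)
      (by norm_num) (by norm_num) (by norm_num) (by norm_num) (by norm_num) ?_ ?_ ?_ ?_⟩
      <;> norm_num <;> linarith

theorem eventually_exists_lt_choose_mul_pow :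
    ∀ᶠ n : ℕ in atTop, ∀ k : ℕ, (7 / 18 : ℝ) * n ≤ k → (k : ℝ) ≤ 21 / 46 * n →
      ∃ t : ℝ, 0 < t ∧ t ≤ 1 ∧
        (1.074 : ℝ) ^ (2 * n + 3) * (1 + t + t ^ 2) ^ n < n.choose k * 2 ^ k * t ^ k := by
  -- As 1.1535 > 1.074² = 1.153476, the exponential gain absorbs the factor n + 1 of the entropy
  -- bound and the 1.074³ from the exponent 2n + 3.
  have hlim : ∀ᶠ n : ℕ in atTop,
      (1.074 : ℝ) ^ 3 * ((n : ℝ) + 1) < (1.1535 / 1.074 ^ 2 : ℝ) ^ n := by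
    have h1 := tendsto_pow_const_div_const_pow_of_one_lt 1
      (show (1 : ℝ) < 1.1535 / 1.074 ^ 2 by norm_num)
    filter_upwards [h1.eventually_lt_const (show (0 : ℝ) < 1 / 4 by norm_num),
      eventually_ge_atTop 1] with n h hn
    rw [div_lt_iff₀ (by positivity), pow_one] at h
    have : (1 : ℝ) ≤ n := by exact_mod_cast hn
    norm_num at h ⊢
    linarith
  filter_upwards [hlim, eventually_ge_atTop 1] with n hn hn1 k hk1 hk2
  have hn0 : (0 : ℝ) < n := by exact_mod_cast hn1
  have hk0 : (0 : ℝ) < k := by linarith [mul_pos (show (0 : ℝ) < 7 / 18 by norm_num) hn0]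
  have hkn : (k : ℝ) < n := by linarith
  obtain ⟨t, ht0, ht1, hrate⟩ := exists_log_le_signRate (κ := k / n)
    (by rw [le_div_iff₀ hn0]; exact hk1) (by rw [div_le_iff₀ hn0]; exact hk2)
  refine ⟨t, ht0, ht1, ?_⟩
  have hent := Nat.exp_mul_binEntropy_le (n := n) (k := k) (by exact_mod_cast hk0)
    (by exact_mod_cast hkn)
  have hpos : 0 < 1 + t + t ^ 2 := by positivity
  have h1 : (1.1535 : ℝ) ^ n * (1 + t + t ^ 2) ^ n ≤
      Real.exp (n * Real.binEntropy (k / n)) * (2 * t) ^ k := by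
    rw [← Real.exp_log (show (0 : ℝ) < 1.1535 ^ n by positivity),
      ← Real.exp_log (pow_pos hpos n), ← Real.exp_log (show 0 < (2 * t) ^ k by positivity),
      ← Real.exp_add, ← Real.exp_add, Real.exp_le_exp, Real.log_pow, Real.log_pow, Real.log_pow]
    have h2 := mul_le_mul_of_nonneg_left hrate hn0.le
    have h3 : (n : ℝ) * (k / n * Real.log (2 * t)) = k * Real.log (2 * t) := by field_simp
    simp only [signRate, mul_sub, mul_add, h3] at h2
    linarith
  have h2 : (1.074 : ℝ) ^ 3 * ((n : ℝ) + 1) * (1.074 ^ 2) ^ n < 1.1535 ^ n := by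
    rw [div_pow, lt_div_iff₀ (by positivity)] at hn
    exact hn
  have hP : 0 < (1 + t + t ^ 2) ^ n := pow_pos hpos n
  refine lt_of_mul_lt_mul_left ?_ (show (0 : ℝ) ≤ (n : ℝ) + 1 by positivity)
  calc ((n : ℝ) + 1) * (1.074 ^ (2 * n + 3) * (1 + t + t ^ 2) ^ n)
      = (1.074 ^ 3 * ((n : ℝ) + 1) * (1.074 ^ 2) ^ n) * (1 + t + t ^ 2) ^ n := by
        rw [pow_add, pow_mul]; ring
    _ < 1.1535 ^ n * (1 + t + t ^ 2) ^ n := by gcongr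
    _ ≤ Real.exp (n * Real.binEntropy (k / n)) * (2 * t) ^ k := h1
    _ ≤ (((n : ℝ) + 1) * n.choose k) * (2 * t) ^ k := by gcongr
    _ = ((n : ℝ) + 1) * (n.choose k * 2 ^ k * t ^ k) := by rw [mul_pow]; ring

/-- For large `n` some sign vector graph in dimension `n` has chromatic number at least
`1.074 ^ (2 n + 3)`. -/
theorem eventually_exists_graph_not_colorable :
    ∀ᶠ n : ℕ in atTop, ∃ k : ℕ, ∀ c : ℕ, (c : ℝ) ≤ 1.074 ^ (2 * n + 3) →
      ¬ (SignVector.graph n k).Colorable c := by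
  -- The weight is p - 1, hence the shift by 1. As 1.1735 · 7/18 < 21/46, the shift stays inside the
  -- window once n ≥ 10000.
  have hx : Tendsto (fun n : ℕ => (7 / 18 : ℝ) * n + 1) atTop atTop :=
    tendsto_atTop_add_const_right _ _
      (tendsto_natCast_atTop_atTop.const_mul_atTop (by norm_num))
  filter_upwards [hx.eventually eventually_exists_prime_mem_Ioc,
    eventually_exists_lt_choose_mul_pow, eventually_ge_atTop 10000] with n hp hn hn1
  obtain ⟨p, hp, hlo, hhi⟩ := hp
  have hn1' : (10000 : ℝ) ≤ n := by exact_mod_cast hn1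
  have hcast : ((p - 1 : ℕ) : ℝ) = p - 1 := by rw [Nat.cast_sub hp.one_le, Nat.cast_one]
  refine ⟨p - 1, fun c hc hcol => ?_⟩
  obtain ⟨t, ht0, ht1, ht⟩ := hn (p - 1) (by rw [hcast]; linarith) (by rw [hcast]; linarith)
  have := Fact.mk hp
  have h1 := SignVector.card_le_of_graph_colorable hcol
  have h2 := (SignVector.choose_mul_two_pow_le_card_ofWeight n (p - 1)).trans h1
  have h3 : ((n.choose (p - 1) : ℝ) * 2 ^ (p - 1)) ≤
      c * (SignVector.exponents n (p - 1)).card := by exact_mod_cast h2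
  have h4 := SignVector.card_exponents_mul_pow_le n (p - 1) ht0.le ht1
  have : (n.choose (p - 1) : ℝ) * 2 ^ (p - 1) * t ^ (p - 1) ≤
      1.074 ^ (2 * n + 3) * (1 + t + t ^ 2) ^ n := by
    calc (n.choose (p - 1) : ℝ) * 2 ^ (p - 1) * t ^ (p - 1)
        ≤ c * (SignVector.exponents n (p - 1)).card * t ^ (p - 1) := by gcongr
      _ = c * ((SignVector.exponents n (p - 1)).card * t ^ (p - 1)) := by ring
      _ ≤ 1.074 ^ (2 * n + 3) * (1 + t + t ^ 2) ^ n := by gcongr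
  linarith

/-! ### Sparse graphs of large girth mapping to a given graph -/

namespace SimpleGraph

variable {V X : Type*}

theorem mem_edgeSet_of_mem_edgeSet_sup_edge {H : SimpleGraph X} {a b : X} {e : Sym2 X}
    (he : e ∈ (H ⊔ edge a b).edgeSet) (hne : e ≠ s(a, b)) : e ∈ H.edgeSet := by
  rw [edgeSet_sup] at he
  rcases he with h | h
  · exact h
  · exact absurd (edgeSet_edge_subset h) hne

/-- A trail through the edge `ab` of `H ⊔ edge a b` splits at that edge into two walks in `H`. -/
theorem Walk.exists_split_of_mem_edges {H : SimpleGraph X} {a b u v : X}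
    (p : (H ⊔ edge a b).Walk u v) (hp : p.edges.Nodup) (hab : s(a, b) ∈ p.edges) :
    ∃ (x y : X) (q₁ : H.Walk u x) (q₂ : H.Walk y v), s(x, y) = s(a, b) ∧
      q₁.length + q₂.length + 1 = p.length := by
  induction p with
  | nil => simp at hab
  | @cons u w v h p ih =>
    rw [Walk.edges_cons, List.nodup_cons] at hp
    by_cases huw : s(u, w) = s(a, b)
    · rw [huw] at hp
      refine ⟨u, w, Walk.nil, p.transfer H fun e he => ?_, huw, by simp⟩
      exact mem_edgeSet_of_mem_edgeSet_sup_edge (p.edges_subset_edgeSet he)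
        fun h' => hp.1 (h' ▸ he)
    · rw [Walk.edges_cons, List.mem_cons] at hab
      obtain ⟨x, y, q₁, q₂, hxy, hlen⟩ := ih hp.2 (hab.resolve_left (Ne.symm huw))
      have huw' : H.Adj u w := mem_edgeSet_of_mem_edgeSet_sup_edge (e := s(u, w)) h huw
      refine ⟨x, y, Walk.cons huw' q₁, q₂, hxy, ?_⟩
      simp only [Walk.length_cons]
      omega

/-- Deleting the new edge from a cycle through it leaves a walk in H between a and b, one shorter
than the cycle. -/
theorem le_egirth_sup_edge {H : SimpleGraph X} {a b : X} {g : ℕ} (hg : (g : ℕ∞) ≤ H.egirth)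
    (hab : ∀ q : H.Walk a b, g ≤ q.length + 1) : (g : ℕ∞) ≤ (H ⊔ edge a b).egirth := by
  rw [le_egirth] at hg ⊢
  intro u p hp
  by_cases h : s(a, b) ∈ p.edges
  · obtain ⟨x, y, q₁, q₂, hxy, hlen⟩ := p.exists_split_of_mem_edges hp.edges_nodup h
    have key : g ≤ (q₂.append q₁).length + 1 := by
      rcases Sym2.eq_iff.1 hxy with ⟨rfl, rfl⟩ | ⟨rfl, rfl⟩
      · simpa [add_comm] using hab (q₂.append q₁).reverse
      · exact hab (q₂.append q₁)
    rw [Walk.length_append] at key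
    exact_mod_cast (by omega : g ≤ p.length)
  · have hmem : ∀ e ∈ p.edges, e ∈ H.edgeSet := fun e he =>
      mem_edgeSet_of_mem_edgeSet_sup_edge (p.edges_subset_edgeSet he) fun h' => h (h' ▸ he)
    simpa using hg u (p.transfer H hmem) (hp.transfer hmem)

open Classical in
theorem card_filter_exists_walk_le [Fintype X] {H : SimpleGraph X} {D : ℕ}
    (hD : ∀ w, H.degree w ≤ D) (a : X) (L : ℕ) :
    (Finset.univ.filter fun b => ∃ q : H.Walk a b, q.length ≤ L).card ≤ (D + 1) ^ L := by
  induction L with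
  | zero =>
    rw [pow_zero, Finset.card_le_one]
    simp only [Finset.mem_filter, Finset.mem_univ, true_and]
    rintro b ⟨q, hq⟩ b' ⟨q', hq'⟩
    rw [← Walk.eq_of_length_eq_zero (Nat.le_zero.1 hq),
      ← Walk.eq_of_length_eq_zero (Nat.le_zero.1 hq')]
  | succ L ih =>
    have hsub : (Finset.univ.filter fun b => ∃ q : H.Walk a b, q.length ≤ L + 1) ⊆
        (Finset.univ.filter fun b => ∃ q : H.Walk a b, q.length ≤ L).biUnion
          fun w => insert w (H.neighborFinset w) := by
      intro b hb
      simp only [Finset.mem_filter, Finset.mem_univ, true_and] at hb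
      obtain ⟨q, hq⟩ := hb
      simp only [Finset.mem_biUnion, Finset.mem_filter, Finset.mem_univ, true_and,
        Finset.mem_insert, mem_neighborFinset]
      rcases Nat.lt_or_ge L q.length with hL | hL
      · have hnil : ¬ q.Nil := by
          rw [← Walk.length_eq_zero_iff]; omega
        refine ⟨q.penultimate, ⟨q.dropLast, ?_⟩, Or.inr (q.adj_penultimate hnil)⟩
        have := q.length_dropLast_add_one hnil
        omega
      · exact ⟨b, ⟨q, hL⟩, Or.inl rfl⟩
    refine (Finset.card_le_card hsub).trans ((Finset.card_biUnion_le_card_mul _ _ (D + 1)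
      fun w _ => ?_).trans ?_)
    · refine (Finset.card_insert_le _ _).trans ?_
      rw [card_neighborFinset_eq_degree]
      exact Nat.succ_le_succ (hD w)
    · rw [pow_succ]
      gcongr

open Classical in
/-- The pairs that cannot be joined by an edge without exceeding degree `D` or creating a
short cycle. -/
noncomputable def blockedPairs [Fintype X] (H : SimpleGraph X) (D g : ℕ) : Finset (X × X) :=
  {q | D ≤ H.degree q.1 ∨ D ≤ H.degree q.2 ∨ ∃ w : H.Walk q.1 q.2, w.length ≤ g}

open Classical in
-- At most T/D vertices have degree at least D, by Markov's inequality, and a ball of radius g has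
-- at most (D + 1)^g vertices.
theorem card_blockedPairs_le [Fintype X] {H : SimpleGraph X} {D T : ℕ} (g : ℕ)
    (hD : ∀ w, H.degree w ≤ D) (hT : ∑ w, H.degree w ≤ T) :
    D * (H.blockedPairs D g).card ≤
      2 * T * Fintype.card X + D * (Fintype.card X * (D + 1) ^ g) := by
  set F : Finset X := {w | D ≤ H.degree w} with hF
  have hFT : F.card * D ≤ T := by
    rw [← smul_eq_mul]
    exact (Finset.card_nsmul_le_sum F _ D fun w hw => (Finset.mem_filter.1 hw).2).trans
      ((Finset.sum_le_sum_of_subset (Finset.subset_univ F)).trans hT)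
  have hsub : H.blockedPairs D g ⊆ (F ×ˢ Finset.univ ∪ Finset.univ ×ˢ F) ∪
      (Finset.univ.sigma fun a => Finset.univ.filter fun b => ∃ q : H.Walk a b, q.length ≤ g).map
        (Equiv.sigmaEquivProd X X).toEmbedding := by
    intro q hq
    simp only [blockedPairs, Finset.mem_filter, Finset.mem_univ, true_and] at hq
    rcases hq with h | h | h
    · simp [hF, h]
    · simp [hF, h]
    · refine Finset.mem_union_right _ (Finset.mem_map.2 ⟨⟨q.1, q.2⟩, ?_, rfl⟩)
      simpa using h
  have h1 : (H.blockedPairs D g).card ≤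
      (F.card * Fintype.card X + Fintype.card X * F.card) + Fintype.card X * (D + 1) ^ g := by
    refine (Finset.card_le_card hsub).trans ((Finset.card_union_le _ _).trans ?_)
    refine add_le_add ((Finset.card_union_le _ _).trans ?_) ?_
    · simp [Finset.card_product]
    · rw [Finset.card_map, Finset.card_sigma]
      refine (Finset.sum_le_card_nsmul _ _ _ fun a _ => card_filter_exists_walk_le hD a g).trans ?_
      simp
  calc D * (H.blockedPairs D g).card
      ≤ D * ((F.card * Fintype.card X + Fintype.card X * F.card)
          + Fintype.card X * (D + 1) ^ g) := by gcongr
    _ = 2 * (F.card * D) * Fintype.card X + D * (Fintype.card X * (D + 1) ^ g) := by ring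
    _ ≤ _ := by gcongr

open Classical in
/-- The proper colorings of a graph, as a finset of functions. -/
noncomputable def properColorings [Fintype X] (H : SimpleGraph X) (c : ℕ) : Finset (X → Fin c) :=
  {f | ∀ a b, H.Adj a b → f a ≠ f b}

open Classical in
/-- Some unblocked edge of `K` is monochromatic in a positive proportion of all proper
colorings of `H`. -/
theorem exists_edge_card_le [Fintype X] {K H : SimpleGraph X} {c g D m : ℕ} {η : ℝ} (hc : 0 < c)
    (hm : 0 < m)
    (hmono : ∀ f : X → Fin c, m ≤
      (Finset.univ.filter fun q : X × X => K.Adj q.1 q.2 ∧ f q.1 = f q.2).card)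
    (hblocked : 2 * (H.blockedPairs D g).card ≤ m)
    (hη : η * (2 * (Fintype.card X : ℝ) ^ 2) ≤ m) :
    ∃ a b, K.Adj a b ∧ (a, b) ∉ H.blockedPairs D g ∧
      η * (H.properColorings c).card ≤
        ((H.properColorings c).filter fun f => f a = f b).card := by
  set S := H.properColorings c
  set A : Finset (X × X) := {q | K.Adj q.1 q.2 ∧ q ∉ H.blockedPairs D g} with hA
  -- Blocked pairs account for at most m/2, so every coloring keeps m/2 usable monochromatic pairs.
  -- Double counting over at most |X|² pairs then gives one that is monochromatic in a proportion η
  -- of S.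
  have hgood : ∀ f : X → Fin c, m ≤ 2 * (A.filter fun q => f q.1 = f q.2).card := by
    intro f
    have hsub : (Finset.univ.filter fun q : X × X => K.Adj q.1 q.2 ∧ f q.1 = f q.2) ⊆
        (A.filter fun q => f q.1 = f q.2) ∪ H.blockedPairs D g := by
      intro q hq
      simp only [Finset.mem_filter, Finset.mem_univ, true_and, hA, Finset.mem_union] at hq ⊢
      tauto
    have h1 := (hmono f).trans ((Finset.card_le_card hsub).trans (Finset.card_union_le _ _))
    omega
  by_contra! hcon
  have hlt : ∀ q ∈ A, ((S.filter fun f => f q.1 = f q.2).card : ℝ) < η * S.card := by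
    intro q hq
    simp only [hA, Finset.mem_filter, Finset.mem_univ, true_and] at hq
    exact hcon q.1 q.2 hq.1 hq.2
  have hdouble : ∑ q ∈ A, (S.filter fun f => f q.1 = f q.2).card =
      ∑ f ∈ S, (A.filter fun q => f q.1 = f q.2).card :=
    Finset.sum_card_bipartiteAbove_eq_sum_card_bipartiteBelow
      (fun (q : X × X) (f : X → Fin c) => f q.1 = f q.2)
  have hlow : S.card * m ≤ 2 * ∑ q ∈ A, (S.filter fun f => f q.1 = f q.2).card := by
    rw [hdouble, Finset.mul_sum, ← smul_eq_mul]
    exact Finset.card_nsmul_le_sum _ _ _ fun f _ => hgood f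
  have hAne : A.Nonempty := by
    have h1 := hgood fun _ => ⟨0, hc⟩
    have h2 : 0 < (A.filter fun q : X × X => (⟨0, hc⟩ : Fin c) = ⟨0, hc⟩).card := by omega
    exact (Finset.card_pos.1 h2).mono (Finset.filter_subset _ _)
  have hη0 : 0 ≤ η * S.card := by
    obtain ⟨q, hq⟩ := hAne
    exact (Nat.cast_nonneg _).trans (hlt q hq).le
  have hup : (∑ q ∈ A, ((S.filter fun f => f q.1 = f q.2).card : ℝ)) <
      (Fintype.card X : ℝ) ^ 2 * (η * S.card) := by
    refine (Finset.sum_lt_sum_of_nonempty hAne hlt).trans_le ?_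
    rw [Finset.sum_const, nsmul_eq_mul]
    refine mul_le_mul_of_nonneg_right ?_ hη0
    have := Finset.card_le_univ A
    rw [Fintype.card_prod] at this
    rw [sq]
    exact_mod_cast this
  have hlow' : (S.card : ℝ) * m ≤
      2 * ∑ q ∈ A, ((S.filter fun f => f q.1 = f q.2).card : ℝ) := by exact_mod_cast hlow
  have h3 := mul_le_mul_of_nonneg_right hη (Nat.cast_nonneg (α := ℝ) S.card)
  nlinarith

theorem degree_le_of_eq_sup_edge [DecidableEq X] {H H' : SimpleGraph X} {a b : X}
    (h : H' = H ⊔ edge a b) (w : X) [Fintype (H'.neighborSet w)] [Fintype (H.neighborSet w)] :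
    H'.degree w ≤ H.degree w + ((if w = a then 1 else 0) + (if w = b then 1 else 0)) := by
  have hsub : H'.neighborFinset w ⊆ H.neighborFinset w ∪
      ((if w = a then {b} else ∅) ∪ (if w = b then {a} else ∅)) := by
    intro x hx
    rw [mem_neighborFinset, h, sup_adj, edge_adj] at hx
    rw [Finset.mem_union, Finset.mem_union, mem_neighborFinset]
    rcases hx with h | ⟨⟨rfl, rfl⟩ | ⟨rfl, rfl⟩, -⟩
    · exact Or.inl h
    · simp
    · simp
  rw [← card_neighborFinset_eq_degree, ← card_neighborFinset_eq_degree]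
  refine (Finset.card_le_card hsub).trans ((Finset.card_union_le _ _).trans ?_)
  refine Nat.add_le_add_left ((Finset.card_union_le _ _).trans (Nat.add_le_add ?_ ?_)) _
  · split_ifs <;> simp
  · split_ifs <;> simp

open Classical in
/-- Greedy choice of `i` edges of `K`, keeping the girth large and the degrees bounded, while
the number of proper colorings decreases geometrically. -/
theorem exists_greedy [Fintype X] {K : SimpleGraph X} {c g D m T : ℕ} {η : ℝ} (hc : 0 < c)
    (hm : 0 < m) (hη1 : η ≤ 1)
    (hmono : ∀ f : X → Fin c, m ≤
      (Finset.univ.filter fun q : X × X => K.Adj q.1 q.2 ∧ f q.1 = f q.2).card)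
    (hblocked : ∀ H : SimpleGraph X, (∀ w, H.degree w ≤ D) → ∑ w, H.degree w ≤ 2 * T →
      2 * (H.blockedPairs D g).card ≤ m)
    (hη : η * (2 * (Fintype.card X : ℝ) ^ 2) ≤ m) (i : ℕ) (hi : i ≤ T) :
    ∃ H : SimpleGraph X, H ≤ K ∧ (g : ℕ∞) ≤ H.egirth ∧ (∀ w, H.degree w ≤ D) ∧
      ∑ w, H.degree w ≤ 2 * i ∧
      ((H.properColorings c).card : ℝ) ≤ (c : ℝ) ^ Fintype.card X * (1 - η) ^ i := by
  induction i with
  | zero =>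
    refine ⟨⊥, bot_le, by simp, by simp, by simp, ?_⟩
    rw [pow_zero, mul_one]
    have := Finset.card_le_univ ((⊥ : SimpleGraph X).properColorings c)
    rw [Fintype.card_fun, Fintype.card_fin] at this
    exact_mod_cast this
  | succ i ih =>
    obtain ⟨H, hHK, hHg, hHD, hHs, hHc⟩ := ih (by omega)
    obtain ⟨a, b, hab, hbl, hcard⟩ := exists_edge_card_le (η := η) hc hm hmono
      (hblocked H hHD (by omega)) hη
    simp only [blockedPairs, Finset.mem_filter, Finset.mem_univ, true_and, not_or, not_le,
      not_exists] at hbl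
    obtain ⟨ha, hb, hw⟩ := hbl
    have hne : a ≠ b := hab.ne
    obtain ⟨H', hH'⟩ : ∃ H', H' = H ⊔ edge a b := ⟨_, rfl⟩
    refine ⟨H', hH' ▸ sup_le hHK ((edge_le_iff K).2 (Or.inr hab)), ?_, fun w => ?_, ?_, ?_⟩
    · exact hH' ▸ le_egirth_sup_edge hHg fun q => by have := hw q; omega
    · have h1 := degree_le_of_eq_sup_edge hH' w
      have h2 := hHD w
      by_cases hwa : w = a
      · subst hwa
        simp only [if_true, if_neg hne] at h1
        omega
      · by_cases hwb : w = b
        · subst hwb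
          simp only [if_true, if_neg hwa] at h1
          omega
        · simp only [if_neg hwa, if_neg hwb] at h1
          omega
    · refine (Finset.sum_le_sum fun w _ => degree_le_of_eq_sup_edge hH' w).trans ?_
      rw [Finset.sum_add_distrib, Finset.sum_add_distrib]
      simp only [Finset.sum_ite_eq', Finset.mem_univ, if_true]
      omega
    · have hsub : H'.properColorings c ⊆
          (H.properColorings c).filter fun f => ¬ f a = f b := by
        intro f hf
        simp only [properColorings, Finset.mem_filter, Finset.mem_univ, true_and] at hf ⊢
        rw [hH'] at hf
        refine ⟨fun x y hxy => hf x y (Or.inl hxy), hf a b (Or.inr ?_)⟩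
        rw [edge_adj]
        exact ⟨Or.inl ⟨rfl, rfl⟩, hne⟩
      have h1 := Finset.card_le_card hsub
      have h2 := Finset.card_filter_add_card_filter_not (s := H.properColorings c)
        (fun f => f a = f b)
      have h1' : ((H'.properColorings c).card : ℝ) ≤
        ((H.properColorings c).filter fun f => ¬ f a = f b).card := by exact_mod_cast h1
      have h2' : (((H.properColorings c).filter fun f => f a = f b).card : ℝ) +
        ((H.properColorings c).filter fun f => ¬ f a = f b).card = (H.properColorings c).card := by
        exact_mod_cast h2
      calc ((H'.properColorings c).card : ℝ)
          ≤ (1 - η) * (H.properColorings c).card := by linarith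
        _ ≤ (1 - η) * ((c : ℝ) ^ Fintype.card X * (1 - η) ^ i) := by
          refine mul_le_mul_of_nonneg_left hHc (by linarith)
        _ = _ := by rw [pow_succ]; ring

open Classical in
/-- If `G` is not `c`-colorable, every `c`-coloring of a blow-up of `G` has many monochromatic
edges. -/
theorem le_card_monochromatic [Fintype V] {G : SimpleGraph V} {c : ℕ} (hc : 0 < c)
    (hG : ¬ G.Colorable c) (M : ℕ) (f : V × Fin (c * M) → Fin c) :
    M * M ≤ (Finset.univ.filter fun q : (V × Fin (c * M)) × (V × Fin (c * M)) =>
      (G.comap Prod.fst).Adj q.1 q.2 ∧ f q.1 = f q.2).card := by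
  have : Nonempty (Fin c) := ⟨⟨0, hc⟩⟩
  -- Giving each vertex of G a color used at least M times on its fiber cannot be a proper coloring,
  -- so two adjacent fibers share such a color.
  have hpig : ∀ v : V, ∃ k : Fin c,
      M ≤ (Finset.univ.filter fun i : Fin (c * M) => f (v, i) = k).card := by
    intro v
    obtain ⟨k, -, hk⟩ := Finset.exists_le_card_fiber_of_mul_le_card_of_maps_to
      (s := (Finset.univ : Finset (Fin (c * M)))) (t := (Finset.univ : Finset (Fin c)))
      (f := fun i => f (v, i)) (n := M) (fun _ _ => Finset.mem_univ _) Finset.univ_nonempty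
      (by simp)
    exact ⟨k, hk⟩
  choose κ hκ using hpig
  obtain ⟨u, v, huv, hkuv⟩ : ∃ u v, G.Adj u v ∧ κ u = κ v := by
    by_contra! hcon
    exact hG ⟨Coloring.mk κ fun {u v} h => hcon u v h⟩
  set A : Finset (Fin (c * M)) := {i | f (u, i) = κ u}
  set B : Finset (Fin (c * M)) := {i | f (v, i) = κ v}
  calc M * M ≤ A.card * B.card := Nat.mul_le_mul (hκ u) (hκ v)
    _ = (A ×ˢ B).card := (Finset.card_product _ _).symm
    _ ≤ _ := by
      refine Finset.card_le_card_of_injOn (fun p => ((u, p.1), (v, p.2))) ?_ ?_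
      · intro p hp
        simp only [Finset.coe_product, Set.mem_prod, Finset.mem_coe, A, B, Finset.mem_filter,
          Finset.mem_univ, true_and] at hp
        simp [huv, hp.1, hp.2, hkuv]
      · intro p _ q _ h
        simp only [Prod.mk.injEq, true_and] at h
        exact Prod.ext h.1 h.2

/-- **Sparse incomparability**: a finite graph that is not `c`-colorable is the homomorphic image
of finite graphs of arbitrarily large girth that are not `c`-colorable. -/
theorem exists_large_girth_not_colorable [Fintype V] {G : SimpleGraph V} {c : ℕ} (hc : 0 < c)
    (hG : ¬ G.Colorable c) (g : ℕ) :
    ∃ (N : ℕ) (H : SimpleGraph (V × Fin N)), H ≤ G.comap Prod.fst ∧ (g : ℕ∞) ≤ H.egirth ∧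
      ¬ H.Colorable c := by
  classical
  have hV : 0 < Fintype.card V := by
    rw [Fintype.card_pos_iff]
    by_contra h
    rw [not_nonempty_iff] at h
    exact hG (Colorable.of_isEmpty c)
  set r := Fintype.card V * c with hr
  have hr0 : 0 < r := Nat.mul_pos hV hc
  have hr0' : (0 : ℝ) < r := by exact_mod_cast hr0
  have hr1' : (1 : ℝ) ≤ r := by exact_mod_cast hr0
  -- The blow-up has rM vertices and at least M² monochromatic pairs per coloring, so η does not
  -- depend on M. Hence τ and D can be fixed before M.
  set η : ℝ := 1 / (2 * (r : ℝ) ^ 2) with hη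
  have hη0 : 0 < η := by positivity
  have hη1 : η ≤ 1 := by
    rw [hη, div_le_one (by positivity)]
    nlinarith
  obtain ⟨τ, hτ⟩ := exists_pow_lt_of_lt_one
    (show 0 < ((c : ℝ) ^ r)⁻¹ by positivity) (show 1 - η < 1 by linarith)
  have hτ1 : (1 - η) ^ (τ + 1) < ((c : ℝ) ^ r)⁻¹ :=
    (pow_le_pow_of_le_one (by linarith) (by linarith) (Nat.le_succ τ)).trans_lt hτ
  set D := 16 * (τ + 1) * r with hD
  set M := 4 * r * (D + 1) ^ g with hM
  have hM0 : 0 < M := by positivity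
  set T := (τ + 1) * M with hT
  have hX : Fintype.card (V × Fin (c * M)) = r * M := by
    rw [Fintype.card_prod, Fintype.card_fin, hr, mul_assoc]
  have hblocked : ∀ H : SimpleGraph (V × Fin (c * M)), (∀ w, H.degree w ≤ D) →
      ∑ w, H.degree w ≤ 2 * T → 2 * (H.blockedPairs D g).card ≤ M * M := by
    intro H hHD hHs
    have h1 := card_blockedPairs_le g hHD hHs
    rw [hX] at h1
    have hD0 : 0 < D := by positivity
    refine le_of_mul_le_mul_left (a := D) ?_ hD0
    have h2 : 4 * (2 * (2 * T) * (r * M)) = D * (M * M) := by rw [hT, hD]; ring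
    have h3 : 4 * (r * M * (D + 1) ^ g) = M * M := by
      calc 4 * (r * M * (D + 1) ^ g) = M * (4 * r * (D + 1) ^ g) := by ring
        _ = M * M := by rw [← hM]
    have h4 : 4 * (D * (r * M * (D + 1) ^ g)) = D * (M * M) := by rw [← h3]; ring
    have h5 : D * (2 * (H.blockedPairs D g).card) = 2 * (D * (H.blockedPairs D g).card) := by ring
    omega
  have hη' : η * (2 * (Fintype.card (V × Fin (c * M)) : ℝ) ^ 2) ≤ (M * M : ℕ) := by
    rw [hX, hη]
    push_cast
    refine le_of_eq ?_
    field_simp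
  obtain ⟨H, hHK, hHg, -, -, hHc⟩ := exists_greedy hc (Nat.mul_pos hM0 hM0) hη1
    (le_card_monochromatic hc hG M) hblocked hη' T le_rfl
  refine ⟨c * M, H, hHK, hHg, fun ⟨f⟩ => ?_⟩
  have hmem : (f : V × Fin (c * M) → Fin c) ∈ H.properColorings c := by
    simp only [properColorings, Finset.mem_filter, Finset.mem_univ, true_and]
    exact fun a b hab => f.valid hab
  have h1 : (1 : ℝ) ≤ (H.properColorings c).card := by
    exact_mod_cast Finset.card_pos.2 ⟨_, hmem⟩
  have h2 : (c : ℝ) ^ r * (1 - η) ^ (τ + 1) < 1 := by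
    rw [mul_comm, ← lt_div_iff₀ (by positivity), one_div]
    exact hτ1
  have h3 : (c : ℝ) ^ Fintype.card (V × Fin (c * M)) * (1 - η) ^ T =
      ((c : ℝ) ^ r * (1 - η) ^ (τ + 1)) ^ M := by
    rw [hX, hT, pow_mul _ r M, pow_mul _ (τ + 1) M, mul_pow]
  rw [h3] at hHc
  have h4 : ((c : ℝ) ^ r * (1 - η) ^ (τ + 1)) ^ M < 1 :=
    pow_lt_one₀ (mul_nonneg (by positivity) (pow_nonneg (by linarith) _)) h2 hM0.ne'
  linarith

end SimpleGraph

/-! ### Realization on the sphere and the main theorem -/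

theorem SimpleGraph.IsOrthogonalityGraph.of_coefficients {V ι : Type*} [Fintype ι] {d : ℕ}
    {G : SimpleGraph V} (hd : Fintype.card ι ≤ d) (l : V → ι → ℝ) (hinj : Function.Injective l)
    (hnorm : ∀ v, ∑ i, l v i * l v i = 1) (horth : ∀ u v, G.Adj u v → ∑ i, l u i * l v i = 0) :
    G.IsOrthogonalityGraph (Metric.sphere (0 : EuclideanSpace ℝ (Fin d)) 1) := by
  obtain ⟨e⟩ : Nonempty (ι ↪ Fin d) :=
    Function.Embedding.nonempty_of_card_le (by simpa using hd)
  have ho : Orthonormal ℝ fun i => (EuclideanSpace.single (e i) (1 : ℝ)) :=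
    (EuclideanSpace.orthonormal_single (𝕜 := ℝ) (ι := Fin d)).comp e e.injective
  have hin : ∀ u v, inner ℝ (∑ i, l u i • EuclideanSpace.single (e i) (1 : ℝ))
      (∑ i, l v i • EuclideanSpace.single (e i) (1 : ℝ)) = ∑ i, l u i * l v i := by
    intro u v
    rw [ho.inner_sum]
    simp
  refine ⟨fun v => ∑ i, l v i • EuclideanSpace.single (e i) (1 : ℝ), ?_, ?_, ?_⟩
  · intro u v huv
    apply hinj
    funext i
    have h1 := ho.inner_right_fintype (l u) i
    have h2 := ho.inner_right_fintype (l v) i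
    rw [← h1, ← h2]
    exact congrArg _ huv
  · intro v
    rw [mem_sphere_zero_iff_norm, ← sq_eq_sq₀ (norm_nonneg _) zero_le_one,
      ← real_inner_self_eq_norm_sq, hin, hnorm, one_pow]
  · intro u v huv
    rw [hin, horth u v huv]

/-- A blow-up of a sign vector graph is an orthogonality graph in twice as many dimensions. -/
theorem SignVector.isOrthogonalityGraph_of_le_comap {n k N d : ℕ} (hd : 2 * (n + 1) ≤ d)
    {H : SimpleGraph (SignVector.ofWeight n k × Fin N)}
    (hH : H ≤ (SignVector.graph n k).comap Prod.fst) :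
    H.IsOrthogonalityGraph (Metric.sphere (0 : EuclideanSpace ℝ (Fin d)) 1) := by
  have hcos : ∀ j : Fin N, (0 : ℝ) ≤ (j : ℝ) / N ∧ (j : ℝ) / N ≤ 1 := fun j =>
    ⟨by positivity, div_le_one_of_le₀ (by exact_mod_cast j.2.le) (by positivity)⟩
  -- The coordinate `none`, always 1, makes adjacent vectors orthogonal. It also exposes cos(j/N) in
  -- the tensor product; since cosine is injective and positive on [0, 1], both j and the sign
  -- vector can be recovered.
  set x : SignVector.ofWeight n k → Option (Fin n) → ℝ := fun v i => i.elim 1 fun i => (v.1 i : ℝ)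
    with hx
  set θ : Fin N → Fin 2 → ℝ := fun j => ![Real.cos ((j : ℝ) / N), Real.sin ((j : ℝ) / N)] with hθ
  have hk : (0 : ℝ) < k + 1 := by positivity
  have hdot : ∀ u v, ∑ i, x u i * x v i = 1 + (SignVector.dot ℤ u.1 v.1 : ℤ) := by
    intro u v
    rw [SignVector.intCast_dot, Fintype.sum_option]
    simp [hx, SignVector.dot]
  have hsum : ∀ u v : SignVector.ofWeight n k × Fin N, ∑ i : Option (Fin n) × Fin 2,
      (x u.1 i.1 * θ u.2 i.2 / √(k + 1)) * (x v.1 i.1 * θ v.2 i.2 / √(k + 1)) =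
      (∑ i, x u.1 i * x v.1 i) * (∑ s, θ u.2 s * θ v.2 s) / (k + 1) := by
    intro u v
    rw [Fintype.sum_mul_sum, ← Fintype.sum_prod_type', Finset.sum_div]
    refine Finset.sum_congr rfl fun i _ => ?_
    have h1 : √((k : ℝ) + 1) * √(k + 1) = k + 1 := Real.mul_self_sqrt hk.le
    rw [div_mul_div_comm, h1]
    ring
  refine SimpleGraph.IsOrthogonalityGraph.of_coefficients
    (ι := Option (Fin n) × Fin 2) (by simpa [mul_comm] using hd)
    (fun v i => x v.1 i.1 * θ v.2 i.2 / √(k + 1)) ?_ ?_ ?_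
  · intro u v huv
    have hs : √((k : ℝ) + 1) ≠ 0 := (Real.sqrt_pos.2 hk).ne'
    have heq : ∀ i s, x u.1 i * θ u.2 s = x v.1 i * θ v.2 s := fun i s => by
      have := congrFun huv (i, s)
      exact (div_left_inj' hs).1 this
    have hN : (0 : ℝ) < N := by exact_mod_cast (Nat.zero_le _).trans_lt u.2.2
    have hcos0 : Real.cos ((u.2 : ℝ) / N) = Real.cos ((v.2 : ℝ) / N) := by
      simpa [hx, hθ] using heq none 0
    have h2 : u.2 = v.2 := by
      have hpi := Real.pi_gt_three
      have := Real.injOn_cos ⟨(hcos u.2).1, by linarith [(hcos u.2).2]⟩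
        ⟨(hcos v.2).1, by linarith [(hcos v.2).2]⟩ hcos0
      rw [div_left_inj' hN.ne'] at this
      exact Fin.ext (by exact_mod_cast this)
    refine Prod.ext (Subtype.ext (funext fun i => ?_)) h2
    have hpos : Real.cos ((v.2 : ℝ) / N) ≠ 0 := by
      have hpi := Real.pi_gt_three
      exact (Real.cos_pos_of_mem_Ioo ⟨by linarith [(hcos v.2).1],
        by linarith [(hcos v.2).2]⟩).ne'
    have h3 := heq (some i) 0
    simp only [hx, hθ, Option.elim_some, Matrix.cons_val_zero, h2] at h3
    have h4 := mul_right_cancel₀ hpos h3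
    revert h4
    cases u.1.1 i <;> cases v.1.1 i <;> norm_num
  · intro v
    rw [hsum, hdot, SignVector.dot_self]
    have hv := v.1.2
    simp only [SignVector.ofWeight, Finset.mem_filter] at hv
    rw [hv.2]
    have h1 : ∑ s, θ v.2 s * θ v.2 s = 1 := by
      simp only [hθ, Fin.sum_univ_two, Matrix.cons_val_zero, Matrix.cons_val_one]
      rw [← sq, ← sq, Real.cos_sq_add_sin_sq]
    rw [h1]
    push_cast
    field_simp
    ring
  · intro u v huv
    have h1 : SignVector.dot ℤ u.1.1 v.1.1 = -1 := hH huv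
    rw [hsum, hdot, h1]
    simp

/-- Finiteness ensures the chromatic number is not ⊤, which `toNat` would send to 0. -/
theorem SimpleGraph.lt_toNat_chromaticNumber {V : Type*} [Finite V] {G : SimpleGraph V} {c : ℕ}
    (h : ¬ G.Colorable c) : c < G.chromaticNumber.toNat := by
  by_contra! hle
  exact h ((colorable_chromaticNumber_of_fintype G).mono hle)

theorem eventually_exists_orthogonalityGraph :
    ∀ᶠ d : ℕ in atTop, ∀ g : ℕ, ∃ (V : Type) (_ : Fintype V) (G : SimpleGraph V),
      G.IsOrthogonalityGraph (Metric.sphere (0 : EuclideanSpace ℝ (Fin d)) 1) ∧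
      (g : ℕ∞) ≤ G.egirth ∧ (1.074 : ℝ) ^ d ≤ (G.chromaticNumber.toNat : ℝ) := by
  have hlim : Tendsto (fun d : ℕ => d / 2 - 1) atTop atTop :=
    (tendsto_sub_atTop_nat 1).comp (Nat.tendsto_div_const_atTop two_ne_zero)
  filter_upwards [hlim.eventually eventually_exists_graph_not_colorable, eventually_ge_atTop 2]
    with d hd hd2 g
  obtain ⟨k, hk⟩ := hd
  -- This gives 2(n + 1) ≤ d ≤ 2n + 3: the vectors fit, and the bound with exponent 2n + 3 covers
  -- both parities of d.
  set n := d / 2 - 1 with hn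
  have hpow : (1.074 : ℝ) ^ d ≤ 1.074 ^ (2 * n + 3) :=
    pow_le_pow_right₀ (by norm_num) (by omega)
  set c := ⌊(1.074 : ℝ) ^ d⌋₊ with hc
  have hc1 : 0 < c := Nat.floor_pos.2 (one_le_pow₀ (by norm_num))
  have hcle : (c : ℝ) ≤ 1.074 ^ d := Nat.floor_le (by positivity)
  obtain ⟨N, H, hH, hg, hcol⟩ :=
    SimpleGraph.exists_large_girth_not_colorable hc1 (hk c (hcle.trans hpow)) g
  refine ⟨_, inferInstance, H, SignVector.isOrthogonalityGraph_of_le_comap (by omega) hH, hg, ?_⟩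
  have h1 := SimpleGraph.lt_toNat_chromaticNumber hcol
  have h2 : ((c + 1 : ℕ) : ℝ) ≤ (H.chromaticNumber.toNat : ℝ) := by exact_mod_cast h1
  have h3 := Nat.lt_floor_add_one ((1.074 : ℝ) ^ d)
  rw [← hc] at h3
  push_cast at h2
  linarith

theorem exists_one_vertex_orthogonalityGraph {d : ℕ} (hd : 1 ≤ d) :
    ∃ (V : Type) (_ : Fintype V) (G : SimpleGraph V),
      G.IsOrthogonalityGraph (Metric.sphere (0 : EuclideanSpace ℝ (Fin d)) 1) ∧
      G.egirth = ⊤ ∧ 1 ≤ (G.chromaticNumber.toNat : ℝ) := by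
  refine ⟨Unit, inferInstance, ⊥, ?_, by simp, ?_⟩
  · exact SimpleGraph.IsOrthogonalityGraph.of_coefficients (ι := Unit) (by simpa using hd)
      (fun _ _ => 1) (Function.injective_of_subsingleton _) (by simp) (by simp)
  · have : ¬ (⊥ : SimpleGraph Unit).Colorable 0 := by
      rw [SimpleGraph.colorable_zero_iff]
      simp
    exact_mod_cast SimpleGraph.lt_toNat_chromaticNumber this

theorem mainTheorem1 :
    ∃ ε : ℕ → ℝ, Filter.Tendsto ε Filter.atTop (nhds 0) ∧
      ∀ g d : ℕ, 1 ≤ d →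
        ∃ (V : Type) (_ : Fintype V) (G : SimpleGraph V),
          G.IsOrthogonalityGraph (Metric.sphere (0 : EuclideanSpace ℝ (Fin d)) 1) ∧
          (g : ℕ∞) ≤ G.egirth ∧
          ((1.074 : ℝ) + ε d) ^ d ≤ (G.chromaticNumber.toNat : ℝ) := by
  obtain ⟨d₀, hd₀⟩ := eventually_atTop.1 eventually_exists_orthogonalityGraph
  -- Below d₀ the base becomes 1, so a single vertex suffices.
  refine ⟨fun d => if d₀ ≤ d then 0 else -0.074, ?_, fun g d hd => ?_⟩
  · refine tendsto_const_nhds.congr' ?_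
    filter_upwards [eventually_ge_atTop d₀] with d h
    rw [if_pos h]
  · by_cases h : d₀ ≤ d
    · simpa only [if_pos h, add_zero] using hd₀ d h g
    · obtain ⟨V, hV, G, hG, hgirth, hχ⟩ := exists_one_vertex_orthogonalityGraph hd
      refine ⟨V, hV, G, hG, by simp [hgirth], ?_⟩
      simp only [if_neg h]
      norm_num at hχ ⊢
      exact hχ
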